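/- Let $H$ be a real Hilbert space and let $f:H\to(-\infty,+\infty]$ be proper, convex and lower semicontinuous with $\Omega:=\operatorname{Argmin} f\neq\varnothing$. Let $\rho>0$ and $\operatorname{prox}_{\rho f}(u)=\arg\min_{x}\{\frac1{2\rho}\|x-u\|^2+f(x)\}$. Given $z^{-1},z^0\in H$, real sequences $(\alpha_k)_{k\ge0}$, $(\lambda_k)_{k\ge0}$ and errors $(e^k)_{k\ge0}$ in $H$, let $$\mu^k=z^k+\alpha_k(z^k-z^{k-1}),\qquad z^{k+1}=\mu^k+\lambda_k\big(\operatorname{prox}_{\rho f}\mu^k+e^k-\mu^k\big),\qquad k\ge 0 .$$ Assume that one of the following two sets of conditions holds. (I) For all $k\ge0$, $0\le\alpha_k\le\alpha<1$ and $0<\lambda\le\lambda_k\le\lambda'<2$; $\sum_{k\ge0}\alpha_k\|z^{k+1}-z^k\|^2<+\infty$ and $\sum_{k\ge0}\lambda_k\|e^k\|<+\infty$; $(z^k)$ is bounded. In this case put $\theta=\lambda'$. (II) For all $k\ge0$, $0\le\alpha_k\le\alpha<1$; $\alpha_0=0$ and $(\alpha_k)$ is nondecreasing; there are $\lambda,\sigma,\delta>0$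 with $$\delta>\frac{\alpha[\alpha(1+\alpha)+\sigma]}{1-\alpha^2},\qquad \lambda\le\lambda_k\le\overline\lambda:=2\,\frac{\delta-\alpha[\alpha(1+\alpha)+\alpha\delta+\sigma]}{\delta[1+\alpha(1+\alpha)+\alpha\delta+\sigma]}\quad\text{for all }k\ge0;$$ $(z^k)$ is bounded and $\sum_{k\ge0}\|e^k\|<+\infty$. In this case put $\theta=\overline\lambda$. Then: (i) $\lim_{k\to\infty}\|z^k-z^*\|$ exists for every $z^*\in\Omega$. (ii) $(z^k)$ converges weakly to a point of $\Omega$, that is, to a minimizer of $f$. (iii) For every $z^*\in\Omega$ and every $k\ge1$, $$\min_{1\le i\le k}\|\operatorname{prox}_{\rho f}\mu^i-\mu^i\|^2\le\frac{1}{k\,\lambda\,(2-\theta)}\big(\|z^1-z^*\|^2+\Delta\big),$$ where $$\Delta=\alpha\sum_{k\ge1}\big[\|z^k-z^*\|^2-\|z^{k-1}-z^*\|^2\big]_+ +\sum_{k\ge1}2\|z^{k+1}-z^*\|\,\lambda_k\|e^k\|+\sum_{k\ge1}\alpha_k(1+\alpha_k)\|z^k-z^{k-1}\|^2,$$ and these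 three series converge, so that $\Delta<+\infty$; here $[m]_+=\max\{m,0\}$. -/

import Mathlib

namespace InertialProx

/-- `f : H → (-∞, +∞]` is proper, convex and lower semicontinuous. -/
structure IsProperConvexLsc {H : Type*} [NormedAddCommGroup H] [InnerProductSpace ℝ H]
    (f : H → EReal) : Prop where
  ne_bot : ∀ x, f x ≠ ⊥
  proper : ∃ x, f x ≠ ⊤
  convex : ∀ x y : H, ∀ a b : ℝ, 0 < a → 0 < b → a + b = 1 →
    f (a • x + b • y) ≤ (a : EReal) * f x + (b : EReal) * f y
  lsc : LowerSemicontinuous f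

/-- The set of global minimizers of `f`. -/
def Argmin {H : Type*} (f : H → EReal) : Set H :=
  {x | ∀ y, f x ≤ f y}

/-- `prox_{ρ f}(u)`: the minimizer of `x ↦ ‖x - u‖² / (2ρ) + f x`. -/
noncomputable def prox {H : Type*} [NormedAddCommGroup H] [InnerProductSpace ℝ H]
    (f : H → EReal) (ρ : ℝ) (u : H) : H :=
  Classical.epsilon fun p : H =>
    p ∈ Argmin fun x : H => ((1 / (2 * ρ) * ‖x - u‖ ^ 2 : ℝ) : EReal) + f x

/-- The sequences `z⁰, z¹, …` and `μ⁰, μ¹, …` are generated by the inexact inertial proximal point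
algorithm from the starting points `z⁻¹ = zInit` and `z⁰`. -/
structure IsGenerated {H : Type*} [NormedAddCommGroup H] [InnerProductSpace ℝ H]
    (f : H → EReal) (ρ : ℝ) (α lam : ℕ → ℝ) (e : ℕ → H) (zInit : H) (z μ : ℕ → H) : Prop where
  mu_zero : μ 0 = z 0 + α 0 • (z 0 - zInit)
  mu_succ : ∀ k, μ (k + 1) = z (k + 1) + α (k + 1) • (z (k + 1) - z k)
  z_succ : ∀ k, z (k + 1) = μ k + lam k • (prox f ρ (μ k) + e k - μ k)

/-- First set of conditions; `a`, `l`, `l'` are the constants bounding `α_k` and `λ_k`. -/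
structure ConditionsI {H : Type*} [NormedAddCommGroup H] [InnerProductSpace ℝ H]
    (α lam : ℕ → ℝ) (e z : ℕ → H) (a l l' : ℝ) : Prop where
  alpha_mem : ∀ k, 0 ≤ α k ∧ α k ≤ a
  a_lt_one : a < 1
  l_pos : 0 < l
  lam_mem : ∀ k, l ≤ lam k ∧ lam k ≤ l'
  l'_lt_two : l' < 2
  summable_inertia : Summable fun k => α k * ‖z (k + 1) - z k‖ ^ 2
  summable_error : Summable fun k => lam k * ‖e k‖
  bounded : Bornology.IsBounded (Set.range z)

/-- The upper bound on the relaxation parameters in the second set of conditions. -/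
noncomputable def lamBar (a σ δ : ℝ) : ℝ :=
  2 * ((δ - a * (a * (1 + a) + a * δ + σ)) / (δ * (1 + a * (1 + a) + a * δ + σ)))

/-- Second set of conditions. -/
structure ConditionsII {H : Type*} [NormedAddCommGroup H] [InnerProductSpace ℝ H]
    (α lam : ℕ → ℝ) (e z : ℕ → H) (a l σ δ : ℝ) : Prop where
  alpha_mem : ∀ k, 0 ≤ α k ∧ α k ≤ a
  a_lt_one : a < 1
  alpha_zero : α 0 = 0
  alpha_mono : Monotone α
  l_pos : 0 < l
  σ_pos : 0 < σ
  δ_pos : 0 < δ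
  δ_gt : a * (a * (1 + a) + σ) / (1 - a ^ 2) < δ
  lam_mem : ∀ k, l ≤ lam k ∧ lam k ≤ lamBar a σ δ
  bounded : Bornology.IsBounded (Set.range z)
  summable_error : Summable fun k => ‖e k‖

/-- `[‖z^k - z*‖² - ‖z^{k-1} - z*‖²]₊` for the index `k = j + 1 ≥ 1`. -/
noncomputable def incTerm {H : Type*} [NormedAddCommGroup H] (z : ℕ → H) (zs : H) (j : ℕ) : ℝ :=
  max (‖z (j + 1) - zs‖ ^ 2 - ‖z j - zs‖ ^ 2) 0

/-- `δ_k λ_k ‖e^k‖` with `δ_k = 2 ‖z^{k+1} - z*‖`, for the index `k = j + 1 ≥ 1`. -/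
noncomputable def errTerm {H : Type*} [NormedAddCommGroup H] (lam : ℕ → ℝ) (e z : ℕ → H) (zs : H)
    (j : ℕ) : ℝ :=
  2 * ‖z (j + 2) - zs‖ * lam (j + 1) * ‖e (j + 1)‖

/-- `ρ_k ‖z^k - z^{k-1}‖²` with `ρ_k = α_k (1 + α_k)`, for the index `k = j + 1 ≥ 1`. -/
noncomputable def inertiaTerm {H : Type*} [NormedAddCommGroup H] (α : ℕ → ℝ) (z : ℕ → H)
    (j : ℕ) : ℝ :=
  α (j + 1) * (1 + α (j + 1)) * ‖z (j + 1) - z j‖ ^ 2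

/-- The constant `Δ` of the rate; the theorem asserts separately that its series converge. -/
noncomputable def Delta {H : Type*} [NormedAddCommGroup H] (α lam : ℕ → ℝ) (e z : ℕ → H) (a : ℝ)
    (zs : H) : ℝ :=
  a * (∑' j, incTerm z zs j) + (∑' j, errTerm lam e z zs j) + ∑' j, inertiaTerm α z j

end InertialProx

namespace InertialProx

open Filter Topology
open scoped RealInnerProductSpace

/-! ### Real sequences with summable perturbations. -/

section Sequences

/-! The minimizers of `f` are the fixed points of the proximal map `P`, whose residual `x - P x` is
firmly nonexpansive. Hence each step changes `‖z k - s‖ ^ 2` by at most `a` times its previous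
increase, plus error and inertia terms, minus a multiple of the squared residual at `μ k`
(`IsInertialIteration.sub_le`). Once `∑ ‖z (k + 1) - z k‖ ^ 2` is finite, the perturbations are
summable. Since `a < 1`, so are the positive increments: this gives the limit of the distances, and
telescoping gives the rate. The residuals at `z k` then tend to zero, so demiclosedness and the
Opial lemma give weak convergence.

The crux is the finiteness of that sum, obtained from two different Lyapunov functions. Under (I)
only `∑ α k * ‖z (k + 1) - z k‖ ^ 2` is controlled, with `α k` attached to the later difference. The
Moreau envelope, a smooth convex function with gradient `x - P x`, plus a multiple of the last
squared difference decreases up to summable terms (`summable_of_summable_inertia`). Under (II) the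
function is `‖z (k + 1) - s‖ ^ 2 - α (k + 1) * ‖z k - s‖ ^ 2` plus a multiple of `‖z (k + 1) - z k‖
^ 2`; the bound `lamBar` is what makes it decrease (`summable_of_monotone`). -/

lemma summable_of_le_sub_add {u b s : ℕ → ℝ} {c : ℝ} (hu : ∀ k, c ≤ u k) (hb : ∀ k, 0 ≤ b k)
    (hs0 : ∀ k, 0 ≤ s k) (hs : Summable s) (h : ∀ k, u (k + 1) ≤ u k - b k + s k) :
    Summable b := by
  have hsum : ∀ n, ∑ i ∈ Finset.range n, b i ≤ u 0 - u n + ∑ i ∈ Finset.range n, s i := by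
    intro n
    induction n with
    | zero => simp
    | succ n ih =>
      rw [Finset.sum_range_succ, Finset.sum_range_succ]
      linarith [h n]
  refine summable_of_sum_range_le hb (c := u 0 - c + ∑' i, s i) fun n => ?_
  have := hs.sum_le_tsum (Finset.range n) (fun i _ => hs0 i)
  linarith [hsum n, hu n]

/-- The sequence serves as its own Lyapunov function, with decrease `(1 - a) * t k`. -/
lemma summable_of_le_mul_add {t s : ℕ → ℝ} {a : ℝ} (ha : a < 1) (ht : ∀ k, 0 ≤ t k)
    (hs0 : ∀ k, 0 ≤ s k) (hs : Summable s) (h : ∀ k, t (k + 1) ≤ a * t k + s k) :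
    Summable t := by
  have h1 : Summable fun k => (1 - a) * t k :=
    summable_of_le_sub_add ht (fun k => mul_nonneg (by linarith) (ht k)) hs0 hs
      (fun k => by linarith [h k])
  exact (summable_mul_left_iff (sub_pos.mpr ha).ne').mp h1

/-- Subtracting the partial sums of the positive increments leaves an antitone sequence bounded
below. -/
lemma exists_tendsto_of_summable_posPart {u : ℕ → ℝ} (hu : ∀ k, 0 ≤ u k)
    (h : Summable fun k => max (u (k + 1) - u k) 0) : ∃ d, Tendsto u atTop (𝓝 d) := by
  set S : ℕ → ℝ := fun n => ∑ i ∈ Finset.range n, max (u (i + 1) - u i) 0 with hS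
  have hanti : Antitone fun n => u n - S n := by
    refine antitone_nat_of_succ_le fun n => ?_
    have := le_max_left (u (n + 1) - u n) 0
    simp only [hS, Finset.sum_range_succ]
    linarith
  have hbdd : BddBelow (Set.range fun n => u n - S n) := by
    refine ⟨-∑' i, max (u (i + 1) - u i) 0, ?_⟩
    rintro _ ⟨n, rfl⟩
    have := h.sum_le_tsum (Finset.range n) (fun i _ => le_max_right _ _)
    simp only [hS]
    linarith [hu n]
  refine ⟨_, ((tendsto_atTop_ciInf hanti hbdd).add h.hasSum.tendsto_sum_nat).congr fun n => ?_⟩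
  simp [hS]

end Sequences

/-! ### Weak convergence in Hilbert space. -/

section Weak

variable {H : Type*} [NormedAddCommGroup H] [InnerProductSpace ℝ H] [CompleteSpace H]

/-- A bounded sequence converges weakly along every ultrafilter. -/
lemma exists_tendsto_inner_of_bounded {z : ℕ → H} {C : ℝ} (hz : ∀ k, ‖z k‖ ≤ C)
    (U : Ultrafilter ℕ) : ∃ x : H, ∀ y, Tendsto (fun k => ⟪z k, y⟫) U (𝓝 ⟪x, y⟫) := by
  have hcomp := WeakDual.isCompact_closedBall (𝕜 := ℝ) (E := H) 0 C
  obtain ⟨g, -, hg⟩ := hcomp.ultrafilter_le_nhds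
    (U.map fun k => StrongDual.toWeakDual (InnerProductSpace.toDual ℝ H (z k))) (by
      rw [le_principal_iff]
      refine Filter.mem_map.mpr (Filter.univ_mem' fun k => ?_)
      simpa using hz k)
  refine ⟨(InnerProductSpace.toDual ℝ H).symm (WeakDual.toStrongDual g), fun y => ?_⟩
  have h1 : Tendsto (fun k => StrongDual.toWeakDual (InnerProductSpace.toDual ℝ H (z k)))
      U (𝓝 g) := hg
  have h2 := ((WeakDual.eval_continuous y).tendsto g).comp h1
  rw [InnerProductSpace.toDual_symm_apply]
  exact h2

lemma tendsto_toWeakSpace_of_tendsto_inner {z : ℕ → H} {x : H} {l : Filter ℕ}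
    (h : ∀ y, Tendsto (fun k => ⟪z k, y⟫) l (𝓝 ⟪x, y⟫)) :
    Tendsto (fun k => toWeakSpace ℝ H (z k)) l (𝓝 (toWeakSpace ℝ H x)) := by
  have hinj : Function.Injective (topDualPairing ℝ H).flip := by
    intro u v huv
    refine ext_inner_left ℝ fun y => ?_
    exact DFunLike.congr_fun huv (InnerProductSpace.toDual ℝ H y)
  refine (WeakBilin.tendsto_iff_forall_eval_tendsto (topDualPairing ℝ H).flip hinj).mpr fun g => ?_
  have hg : ∀ u : H, (topDualPairing ℝ H).flip u g
      = ⟪u, (InnerProductSpace.toDual ℝ H).symm g⟫ := by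
    intro u
    rw [real_inner_comm, InnerProductSpace.toDual_symm_apply]
    rfl
  have := h ((InnerProductSpace.toDual ℝ H).symm g)
  simp only [← hg] at this
  exact this

/-- The **Opial lemma** on weak convergence. -/
lemma exists_tendsto_weak_of_opial {z : ℕ → H} {S : Set H} {C : ℝ} (hz : ∀ k, ‖z k‖ ≤ C)
    (hlim : ∀ s ∈ S, ∃ d, Tendsto (fun k => ‖z k - s‖) atTop (𝓝 d))
    (hclu : ∀ (U : Ultrafilter ℕ) (x : H), (U : Filter ℕ) ≤ atTop →
      (∀ y, Tendsto (fun k => ⟪z k, y⟫) U (𝓝 ⟪x, y⟫)) → x ∈ S) :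
    ∃ s ∈ S, Tendsto (fun k => toWeakSpace ℝ H (z k)) atTop (𝓝 (toWeakSpace ℝ H s)) := by
  choose w hw using fun U : Ultrafilter ℕ => exists_tendsto_inner_of_bounded hz U
  have hmem : ∀ U : Ultrafilter ℕ, (U : Filter ℕ) ≤ atTop → w U ∈ S :=
    fun U hU => hclu U _ hU (hw U)
  -- Polarization: `‖z k - y‖ ^ 2 - ‖z k - x‖ ^ 2` is affine in `⟪z k, x - y⟫`.
  have hinner : ∀ x ∈ S, ∀ y ∈ S, ∃ c, Tendsto (fun k => ⟪z k, x - y⟫) atTop (𝓝 c) := by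
    intro x hx y hy
    obtain ⟨d, hd⟩ := hlim x hx
    obtain ⟨d', hd'⟩ := hlim y hy
    refine ⟨_, ((((hd'.pow 2).sub (hd.pow 2)).add_const (‖x‖ ^ 2 - ‖y‖ ^ 2)).div_const 2).congr
      fun k => ?_⟩
    rw [norm_sub_sq_real, norm_sub_sq_real, inner_sub_right]
    ring
  -- Testing two cluster points against their own difference gives the same limit for both, so the
  -- difference is orthogonal to itself.
  have huniq : ∀ U V : Ultrafilter ℕ, (U : Filter ℕ) ≤ atTop → (V : Filter ℕ) ≤ atTop →
      w U = w V := by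
    intro U V hU hV
    obtain ⟨c, hc⟩ := hinner _ (hmem U hU) _ (hmem V hV)
    have h1 := tendsto_nhds_unique (hw U (w U - w V)) (hc.mono_left hU)
    have h2 := tendsto_nhds_unique (hw V (w U - w V)) (hc.mono_left hV)
    rw [← sub_eq_zero, ← inner_self_eq_zero (𝕜 := ℝ), inner_sub_left, h1, h2, sub_self]
  set U₀ : Ultrafilter ℕ := Ultrafilter.of atTop with hU₀
  have hU₀le : (U₀ : Filter ℕ) ≤ atTop := Ultrafilter.of_le atTop
  refine ⟨w U₀, hmem U₀ hU₀le, tendsto_toWeakSpace_of_tendsto_inner fun y => ?_⟩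
  rw [tendsto_iff_ultrafilter]
  intro V hV
  rw [huniq U₀ V hU₀le hV]
  exact hw V y

end Weak

/-! ### Existence and characterization of the proximal point. -/

section Prox

variable {H : Type*} [NormedAddCommGroup H] [InnerProductSpace ℝ H]

lemma IsProperConvexLsc.le_of_le {f : H → EReal} (hf : IsProperConvexLsc f) {x y : H} {r s a b : ℝ}
    (hx : f x ≤ r) (hy : f y ≤ s) (ha : 0 < a) (hb : 0 < b) (hab : a + b = 1) :
    f (a • x + b • y) ≤ ((a * r + b * s : ℝ) : EReal) := by
  refine (hf.convex x y a b ha hb hab).trans ?_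
  push_cast
  exact add_le_add (mul_le_mul_of_nonneg_left hx (by exact_mod_cast ha.le))
    (mul_le_mul_of_nonneg_left hy (by exact_mod_cast hb.le))

lemma IsProperConvexLsc.ne_top_of_mem_Argmin {f : H → EReal} (hf : IsProperConvexLsc f) {x : H}
    (hx : x ∈ Argmin f) : f x ≠ ⊤ := by
  obtain ⟨y, hy⟩ := hf.proper
  exact ((hx y).trans_lt (lt_top_iff_ne_top.mpr hy)).ne

lemma IsProperConvexLsc.le_of_tendsto {f : H → EReal} (hf : IsProperConvexLsc f) {x : ℕ → H}
    {r : ℕ → ℝ} {p : H} {q : ℝ} (hx : Tendsto x atTop (𝓝 p)) (hr : Tendsto r atTop (𝓝 q))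
    (h : ∀ n, f (x n) ≤ r n) : f p ≤ q := by
  have hr' : Tendsto (fun n => (r n : EReal)) atTop (𝓝 (q : EReal)) :=
    (continuous_coe_real_ereal.tendsto q).comp hr
  exact hf.lsc.isClosed_epigraph.mem_of_tendsto (hx.prodMk_nhds hr') (Eventually.of_forall h)

lemma norm_midpoint_sub_sq (x y u : H) :
    ‖(1 / 2 : ℝ) • x + (1 / 2 : ℝ) • y - u‖ ^ 2
      = 1 / 2 * ‖x - u‖ ^ 2 + 1 / 2 * ‖y - u‖ ^ 2 - 1 / 4 * ‖x - y‖ ^ 2 := by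
  have h1 : (1 / 2 : ℝ) • x + (1 / 2 : ℝ) • y - u = (1 / 2 : ℝ) • ((x - u) + (y - u)) := by
    module
  have h2 : x - y = (x - u) - (y - u) := by abel
  rw [h1, h2, norm_smul, mul_pow, norm_add_sq_real, norm_sub_sq_real (x - u)]
  norm_num
  ring

/-- The quadratic term makes the objective strongly convex, so a minimizing sequence is Cauchy and
lower semicontinuity passes to its limit. A minimizer of `f` supplies the lower bound. -/
lemma IsProperConvexLsc.exists_mem_Argmin_prox [CompleteSpace H] {f : H → EReal}
    (hf : IsProperConvexLsc f) (hΩ : (Argmin f).Nonempty) {c : ℝ} (hc : 0 < c) (u : H) :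
    ∃ p, p ∈ Argmin fun x : H => ((c * ‖x - u‖ ^ 2 : ℝ) : EReal) + f x := by
  obtain ⟨x₀, hx₀⟩ := hΩ
  have hx₀top := hf.ne_top_of_mem_Argmin hx₀
  have hcoe := EReal.coe_toReal hx₀top (hf.ne_bot x₀)
  -- Minimizing over the real epigraph of `f` keeps the infimum in `ℝ`.
  set V : Set ℝ := {r | ∃ x : H, ∃ s : ℝ, f x ≤ s ∧ r = c * ‖x - u‖ ^ 2 + s} with hV
  have hVne : V.Nonempty := ⟨_, x₀, (f x₀).toReal, hcoe.symm.le, rfl⟩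
  have hVbdd : BddBelow V := by
    refine ⟨(f x₀).toReal, ?_⟩
    rintro _ ⟨x, s, hs, rfl⟩
    have h1 : ((f x₀).toReal : EReal) ≤ s := hcoe.le.trans ((hx₀ x).trans hs)
    have h2 : (f x₀).toReal ≤ s := by exact_mod_cast h1
    have : 0 ≤ c * ‖x - u‖ ^ 2 := by positivity
    linarith
  have hle : ∀ (x : H) (s : ℝ), f x ≤ s → sInf V ≤ c * ‖x - u‖ ^ 2 + s :=
    fun x s hs => csInf_le hVbdd ⟨x, s, hs, rfl⟩
  have hseq : ∀ n : ℕ, ∃ x : H, ∃ s : ℝ, f x ≤ s ∧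
      c * ‖x - u‖ ^ 2 + s < sInf V + 1 / ((n : ℝ) + 1) := by
    intro n
    obtain ⟨_, ⟨x, s, hs, rfl⟩, hlt⟩ := exists_lt_of_csInf_lt hVne
      (lt_add_of_pos_right (sInf V) (Nat.one_div_pos_of_nat (α := ℝ) (n := n)))
    exact ⟨x, s, hs, hlt⟩
  choose x s hs hlt using hseq
  have hlim : Tendsto (fun n : ℕ => 1 / ((n : ℝ) + 1)) atTop (𝓝 0) :=
    tendsto_one_div_add_atTop_nhds_zero_nat
  have hcauchy : CauchySeq x := by
    refine cauchySeq_of_le_tendsto_0 (fun N : ℕ => √(4 / c * (1 / ((N : ℝ) + 1)))) ?_ ?_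
    · intro n m N hn hm
      rw [dist_eq_norm]
      refine Real.le_sqrt_of_sq_le ?_
      have h1 := hle _ _ (hf.le_of_le (hs n) (hs m) (a := 1 / 2) (b := 1 / 2)
        (by norm_num) (by norm_num) (by norm_num))
      rw [norm_midpoint_sub_sq] at h1
      have h2 := Nat.one_div_le_one_div (α := ℝ) hn
      have h3 := Nat.one_div_le_one_div (α := ℝ) hm
      -- The midpoint value is at least `sInf V`, while both endpoint values are below `sInf V + 1 /
      -- (N + 1)`; the parallelogram deficit pays the difference.
      have h4 : c * ‖x n - x m‖ ^ 2 ≤ 4 * (1 / ((N : ℝ) + 1)) := by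
        linarith [hlt n, hlt m]
      rw [div_mul_eq_mul_div, le_div_iff₀ hc]
      linarith
    · simpa using (hlim.const_mul (4 / c)).sqrt
  obtain ⟨p, hp⟩ := cauchySeq_tendsto_of_complete hcauchy
  have hnorm : Tendsto (fun n => c * ‖x n - u‖ ^ 2) atTop (𝓝 (c * ‖p - u‖ ^ 2)) :=
    ((hp.sub_const u).norm.pow 2).const_mul c
  have hfp : f p ≤ ((sInf V - c * ‖p - u‖ ^ 2 : ℝ) : EReal) := by
    refine hf.le_of_tendsto (r := fun n : ℕ => sInf V + 1 / ((n : ℝ) + 1) - c * ‖x n - u‖ ^ 2)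
      hp ?_ fun n => (hs n).trans ?_
    · simpa using (hlim.const_add (sInf V)).sub hnorm
    · exact EReal.coe_le_coe_iff.mpr (by linarith [hlt n])
  refine ⟨p, fun y => ?_⟩
  have h1 : ((c * ‖p - u‖ ^ 2 : ℝ) : EReal) + f p ≤ (sInf V : ℝ) := by
    refine (add_le_add le_rfl hfp).trans ?_
    exact_mod_cast (by linarith : c * ‖p - u‖ ^ 2 + (sInf V - c * ‖p - u‖ ^ 2) ≤ sInf V)
  by_cases hy : f y = ⊤
  · show _ ≤ ((c * ‖y - u‖ ^ 2 : ℝ) : EReal) + f y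
    rw [hy, EReal.coe_add_top]
    exact le_top
  · refine h1.trans ?_
    have hy' := EReal.coe_toReal hy (hf.ne_bot y)
    have := hle y _ hy'.symm.le
    show _ ≤ ((c * ‖y - u‖ ^ 2 : ℝ) : EReal) + f y
    rw [← hy']
    exact_mod_cast this

variable [CompleteSpace H]

lemma IsProperConvexLsc.prox_mem_Argmin {f : H → EReal} (hf : IsProperConvexLsc f)
    (hΩ : (Argmin f).Nonempty) {ρ : ℝ} (hρ : 0 < ρ) (u : H) :
    prox f ρ u ∈ Argmin fun x : H => ((1 / (2 * ρ) * ‖x - u‖ ^ 2 : ℝ) : EReal) + f x :=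
  Classical.epsilon_spec (hf.exists_mem_Argmin_prox hΩ (c := 1 / (2 * ρ)) (by positivity) u)

lemma IsProperConvexLsc.prox_le {f : H → EReal} (hf : IsProperConvexLsc f)
    (hΩ : (Argmin f).Nonempty) {ρ : ℝ} (hρ : 0 < ρ) (u : H) {y : H} {r : ℝ} (hy : f y ≤ r) :
    f (prox f ρ u) ≠ ⊤ ∧ ‖prox f ρ u - u‖ ^ 2 + 2 * ρ * (f (prox f ρ u)).toReal
      ≤ ‖y - u‖ ^ 2 + 2 * ρ * r := by
  have h := (hf.prox_mem_Argmin hΩ hρ u y).trans (add_le_add le_rfl hy)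
  simp only at h
  have htop : f (prox f ρ u) ≠ ⊤ := by
    intro ht
    rw [ht, EReal.coe_add_top, ← EReal.coe_add] at h
    exact EReal.coe_ne_top _ (top_le_iff.mp h)
  refine ⟨htop, ?_⟩
  rw [← EReal.coe_toReal htop (hf.ne_bot _), ← EReal.coe_add, ← EReal.coe_add,
    EReal.coe_le_coe_iff] at h
  have h2 := mul_le_mul_of_nonneg_left h (by positivity : 0 ≤ 2 * ρ)
  have e : 2 * ρ * (1 / (2 * ρ)) = 1 := by field_simp
  rw [mul_add, mul_add, ← mul_assoc, ← mul_assoc, e, one_mul, one_mul] at h2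
  exact h2

lemma IsProperConvexLsc.prox_ne_top {f : H → EReal} (hf : IsProperConvexLsc f)
    (hΩ : (Argmin f).Nonempty) {ρ : ℝ} (hρ : 0 < ρ) (u : H) : f (prox f ρ u) ≠ ⊤ := by
  obtain ⟨y, hy⟩ := hf.proper
  exact (hf.prox_le hΩ hρ u (EReal.le_coe_toReal hy)).1

/-- Variational characterization of the proximal point. -/
lemma IsProperConvexLsc.prox_inner_le {f : H → EReal} (hf : IsProperConvexLsc f)
    (hΩ : (Argmin f).Nonempty) {ρ : ℝ} (hρ : 0 < ρ) (u : H) {y : H} {r : ℝ} (hy : f y ≤ r) :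
    ρ * (f (prox f ρ u)).toReal + ⟪u - prox f ρ u, y - prox f ρ u⟫ ≤ ρ * r := by
  set p := prox f ρ u with hp
  have hptop : f p ≤ (f p).toReal := EReal.le_coe_toReal (hf.prox_ne_top hΩ hρ u)
  set s := (f p).toReal with hs
  -- Minimality of `p` is tested at `(1 - t) • p + t • y`; after division by `t`, the quadratic
  -- remainder vanishes as `t → 0`.
  have key : ∀ t : ℝ, t ∈ Set.Ioo (0 : ℝ) 1 →
      ρ * s + ⟪u - p, y - p⟫ ≤ ρ * r + t * (‖y - p‖ ^ 2 / 2) := by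
    rintro t ⟨ht0, ht1⟩
    have h1 := (hf.prox_le hΩ hρ u
      (hf.le_of_le hptop hy (sub_pos.mpr ht1) ht0 (sub_add_cancel 1 t))).2
    rw [← hp, ← hs] at h1
    have e : (1 - t) • p + t • y - u = t • (y - p) - (u - p) := by module
    rw [e, norm_sub_sq_real (t • (y - p)), norm_smul, inner_smul_left, mul_pow, Real.norm_eq_abs, sq_abs,
      norm_sub_rev p u, real_inner_comm] at h1
    simp only [conj_trivial] at h1
    have h2 : t * (ρ * s + ⟪u - p, y - p⟫) ≤ t * (ρ * r + t * (‖y - p‖ ^ 2 / 2)) := by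
      linarith
    exact le_of_mul_le_mul_left h2 ht0
  have hlim : Tendsto (fun t : ℝ => ρ * r + t * (‖y - p‖ ^ 2 / 2)) (𝓝[>] 0) (𝓝 (ρ * r)) := by
    have : Tendsto (fun t : ℝ => ρ * r + t * (‖y - p‖ ^ 2 / 2)) (𝓝 0)
        (𝓝 (ρ * r + 0 * (‖y - p‖ ^ 2 / 2))) := by
      apply Continuous.tendsto
      fun_prop
    simpa using this.mono_left nhdsWithin_le_nhds
  exact ge_of_tendsto hlim (eventually_of_mem (Ioo_mem_nhdsGT one_pos) key)

/-- Forward, `x` itself is the competitor in the prox problem, which forces zero displacement.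
Backward, the inner product in the variational inequality vanishes. -/
lemma IsProperConvexLsc.mem_Argmin_iff_prox_eq {f : H → EReal} (hf : IsProperConvexLsc f)
    (hΩ : (Argmin f).Nonempty) {ρ : ℝ} (hρ : 0 < ρ) (x : H) :
    x ∈ Argmin f ↔ prox f ρ x = x := by
  constructor
  · intro hx
    have hxtop := hf.ne_top_of_mem_Argmin hx
    have h1 := (hf.prox_le hΩ hρ x (EReal.le_coe_toReal hxtop)).2
    have h2 := EReal.toReal_le_toReal (hx (prox f ρ x)) (hf.ne_bot x) (hf.prox_ne_top hΩ hρ x)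
    have h3 := mul_le_mul_of_nonneg_left h2 (by positivity : 0 ≤ 2 * ρ)
    rw [sub_self, norm_zero] at h1
    have h4 : ‖prox f ρ x - x‖ ^ 2 ≤ 0 := by linarith
    have h5 : ‖prox f ρ x - x‖ = 0 := pow_eq_zero_iff two_ne_zero |>.mp (le_antisymm h4 (sq_nonneg _))
    exact sub_eq_zero.mp (norm_eq_zero.mp h5)
  · intro hx y
    by_cases hy : f y = ⊤
    · simp [hy]
    have h1 := hf.prox_inner_le hΩ hρ x (EReal.le_coe_toReal hy)
    have htop := hf.prox_ne_top hΩ hρ x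
    rw [hx, sub_self, inner_zero_left, add_zero] at h1
    rw [hx] at htop
    rw [← EReal.coe_toReal htop (hf.ne_bot x), ← EReal.coe_toReal hy (hf.ne_bot y),
      EReal.coe_le_coe_iff]
    exact le_of_mul_le_mul_left h1 hρ

end Prox

/-! ### Residual, Moreau envelope and one-step estimates. -/

section Resolvent

variable {H : Type*} [NormedAddCommGroup H] [InnerProductSpace ℝ H]

/-- `P` satisfies the variational inequality of a proximal map, where `φ x` plays the role of
the value of the (scaled) function at `P x`. -/
def IsProxLike (P : H → H) (φ : H → ℝ) : Prop :=
  ∀ x m, φ m + ⟪m - P m, P x - P m⟫ ≤ φ x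

/-- The Moreau envelope attached to a proximal map. -/
noncomputable def envelope (P : H → H) (φ : H → ℝ) (x : H) : ℝ :=
  1 / 2 * ‖x - P x‖ ^ 2 + φ x

variable {P : H → H} {φ : H → ℝ}

/-- With everything written in the two residuals and `x - m`, the estimates below become expansions
of squares in three free vectors. -/
lemma IsProxLike.inner_residual (hP : IsProxLike P φ) (x m : H) :
    φ m + ⟪m - P m, (x - m) - (x - P x) + (m - P m)⟫ ≤ φ x := by
  have e : (x - m) - (x - P x) + (m - P m) = P x - P m := by abel
  rw [e]
  exact hP x m

/-- Firm nonexpansiveness: the two variational inequalities with the points exchanged are added. -/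
lemma IsProxLike.norm_residual_sub_sq_le (hP : IsProxLike P φ) (x y : H) :
    ‖(x - P x) - (y - P y)‖ ^ 2 ≤ ⟪(x - P x) - (y - P y), x - y⟫ := by
  have h1 := hP.inner_residual x y
  have h2 := hP.inner_residual y x
  rw [← neg_sub x y] at h2
  generalize x - P x = g at *
  generalize y - P y = h at *
  generalize x - y = w at *
  simp only [inner_add_right, inner_sub_right, inner_sub_left, inner_neg_right,
    real_inner_self_eq_norm_sq, norm_sub_sq_real, real_inner_comm g h] at *
  linarith

lemma IsProxLike.norm_residual_sub_le (hP : IsProxLike P φ) (x y : H) :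
    ‖(x - P x) - (y - P y)‖ ≤ ‖x - y‖ := by
  have h := (hP.norm_residual_sub_sq_le x y).trans (real_inner_le_norm _ _)
  by_contra! hlt
  nlinarith [norm_nonneg (x - y)]

/-- Descent lemma for a function with 1-Lipschitz gradient `m - P m`; the discarded square is `‖P x
- P m‖ ^ 2`. -/
lemma IsProxLike.envelope_le (hP : IsProxLike P φ) (x m : H) :
    envelope P φ x ≤ envelope P φ m + ⟪m - P m, x - m⟫ + 1 / 2 * ‖x - m‖ ^ 2 := by
  have hv := hP.inner_residual m x
  have h0 := sq_nonneg ‖(m - P m) + (x - m) - (x - P x)‖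
  unfold envelope
  rw [← neg_sub x m] at hv
  generalize x - P x = g at *
  generalize m - P m = h at *
  generalize x - m = w at *
  simp only [inner_add_right, inner_sub_right, inner_add_left, inner_neg_right,
    real_inner_self_eq_norm_sq, norm_sub_sq_real, norm_add_sq_real, real_inner_comm g h,
    real_inner_comm g w] at *
  linarith

/-- Gradient inequality for the convex envelope. -/
lemma IsProxLike.le_envelope (hP : IsProxLike P φ) (x m : H) :
    envelope P φ m + ⟪m - P m, x - m⟫ ≤ envelope P φ x := by
  have hv := hP.inner_residual x m
  have h0 := sq_nonneg ‖(x - P x) - (m - P m)‖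
  unfold envelope
  generalize x - P x = g at *
  generalize m - P m = h at *
  generalize x - m = w at *
  simp only [inner_add_right, inner_sub_right,
    real_inner_self_eq_norm_sq, norm_sub_sq_real, real_inner_comm g h] at *
  linarith

lemma IsProxLike.envelope_le_of_fixed (hP : IsProxLike P φ) {s : H} (hs : P s = s) (x : H) :
    envelope P φ s ≤ envelope P φ x := by
  simpa [hs] using hP.le_envelope x s

lemma IsProxLike.norm_residual_sq_le_inner (hP : IsProxLike P φ) {s : H} (hs : P s = s) (x : H) :
    ‖x - P x‖ ^ 2 ≤ ⟪x - P x, x - s⟫ := by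
  simpa [hs] using hP.norm_residual_sub_sq_le x s

/-- Demiclosedness: weak limits of approximate fixed points are fixed points. -/
lemma IsProxLike.fixed_of_tendsto_inner (hP : IsProxLike P φ) {z : ℕ → H} {C : ℝ}
    (hz : ∀ k, ‖z k‖ ≤ C) {l : Filter ℕ} [l.NeBot] {x : H}
    (hx : ∀ y, Tendsto (fun k => ⟪z k, y⟫) l (𝓝 ⟪x, y⟫))
    (hres : Tendsto (fun k => z k - P (z k)) l (𝓝 0)) : P x = x := by
  have h1 : Tendsto (fun k => ‖(z k - P (z k)) - (x - P x)‖ ^ 2) l (𝓝 (‖0 - (x - P x)‖ ^ 2)) :=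
    ((hres.sub_const _).norm.pow 2)
  have h2 : Tendsto (fun k => ‖z k - P (z k)‖ * (C + ‖x‖) - (⟪z k, x - P x⟫ - ⟪x, x - P x⟫)) l
      (𝓝 (‖(0 : H)‖ * (C + ‖x‖) - (⟪x, x - P x⟫ - ⟪x, x - P x⟫))) :=
    (hres.norm.mul_const _).sub ((hx _).sub_const _)
  -- In the firm nonexpansiveness bound, the residual at `z k` is paired with a bounded vector, and
  -- the fixed residual at `x` with a weakly null one.
  have h3 := le_of_tendsto_of_tendsto h1 h2 (Eventually.of_forall fun k => by
    have e1 := hP.norm_residual_sub_sq_le (z k) x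
    have e2 := (real_inner_le_norm (z k - P (z k)) (z k - x)).trans
      (mul_le_mul_of_nonneg_left ((norm_sub_le (z k) x).trans (add_le_add_left (hz k) _))
        (norm_nonneg _))
    rw [inner_sub_left, real_inner_comm (z k - x) (x - P x), inner_sub_left (z k) x] at e1
    show _ ≤ _
    linarith)
  simp only [zero_sub, norm_neg, norm_zero, zero_mul, sub_self] at h3
  have h4 : ‖x - P x‖ = 0 := pow_eq_zero_iff two_ne_zero |>.mp (le_antisymm h3 (sq_nonneg _))
  exact (sub_eq_zero.mp (norm_eq_zero.mp h4)).symm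

/-- One-step estimate of the relaxed inexact step from the extrapolated point `m`. -/
lemma IsProxLike.norm_relaxed_step_sub_sq_le (hP : IsProxLike P φ) {s m y e : H} {lam : ℝ}
    (hs : P s = s) (hlam : 0 ≤ lam) (hy : y = m + lam • (P m + e - m)) :
    ‖y - s‖ ^ 2 ≤ ‖m - s‖ ^ 2 - lam * (2 - lam) * ‖P m - m‖ ^ 2
      + 2 * ‖y - s‖ * lam * ‖e‖ := by
  have h1 := hP.norm_residual_sq_le_inner hs m
  have e1 : m - s = (y - s) - lam • e + lam • (m - P m) := by rw [hy]; module
  have e2 : (m - s) - lam • (m - P m) = (y - s) - lam • e := by rw [e1]; abel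
  have h2 := real_inner_le_norm (y - s) e
  have h3 := congrArg (fun v => ‖v‖ ^ 2) e2
  simp only [norm_sub_sq_real (m - s), norm_sub_sq_real (y - s), norm_smul, inner_smul_right,
    Real.norm_eq_abs, mul_pow, sq_abs] at h3
  rw [real_inner_comm] at h1
  rw [norm_sub_rev (P m) m]
  have h4 := mul_le_mul_of_nonneg_left h1 hlam
  have h5 := mul_le_mul_of_nonneg_left h2 hlam
  nlinarith [mul_nonneg (sq_nonneg lam) (sq_nonneg ‖e‖)]

lemma norm_extrapolate_sub_sq (x₀ x₁ s : H) (t : ℝ) :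
    ‖x₁ + t • (x₁ - x₀) - s‖ ^ 2
      = ‖x₁ - s‖ ^ 2 + t * (‖x₁ - s‖ ^ 2 - ‖x₀ - s‖ ^ 2) + t * (1 + t) * ‖x₁ - x₀‖ ^ 2 := by
  have e1 : x₁ + t • (x₁ - x₀) - s = (x₁ - s) + t • (x₁ - x₀) := by abel
  have e2 : x₀ - s = (x₁ - s) - (x₁ - x₀) := by abel
  rw [e1, e2, norm_add_sq_real, norm_sub_sq_real (x₁ - s), norm_smul, inner_smul_right,
    Real.norm_eq_abs, mul_pow, sq_abs]
  ring

/-- One-step estimate of the inexact inertial iteration. -/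
lemma IsProxLike.inertial_step_le (hP : IsProxLike P φ) {s x₀ x₁ x₂ m e : H} {t lam : ℝ}
    (hs : P s = s) (hlam : 0 ≤ lam) (hm : m = x₁ + t • (x₁ - x₀))
    (hx₂ : x₂ = m + lam • (P m + e - m)) :
    ‖x₂ - s‖ ^ 2 - ‖x₁ - s‖ ^ 2 ≤ t * (‖x₁ - s‖ ^ 2 - ‖x₀ - s‖ ^ 2)
      - lam * (2 - lam) * ‖P m - m‖ ^ 2 + 2 * ‖x₂ - s‖ * lam * ‖e‖
      + t * (1 + t) * ‖x₁ - x₀‖ ^ 2 := by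
  have h1 := hP.norm_relaxed_step_sub_sq_le hs hlam hx₂
  have h2 := norm_extrapolate_sub_sq x₀ x₁ s t
  rw [← hm] at h2
  linarith

end Resolvent

/-! ### Decrease of the two Lyapunov functions in one step. -/

section Steps

/-- Here `p` and `q` are the previous and new step lengths, and only `t * q ^ 2` will be summable.
For small `t`, the term `t ^ 2 * p ^ 2` fits into `c / 4 * p ^ 2`. Otherwise `1 ≤ 2 / c * t`, so the
whole `q ^ 2` in the second bound is a multiple of `t * q ^ 2`. -/
lemma descent_of_two_bounds {D p q t c K E : ℝ} (hc : 0 < c) (hK : 0 ≤ K) (ht0 : 0 ≤ t)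
    (ht1 : t ≤ 1)
    (h₁ : D ≤ -c * q ^ 2 + K * (t * (p * q)) + 1 / 2 * t ^ 2 * p ^ 2 + E)
    (h₂ : D ≤ K * (t * (p * q)) + K * q ^ 2 + E) :
    D ≤ -c * q ^ 2 + c / 2 * p ^ 2 + (K ^ 2 / c + 2 * (K + c) / c) * (t * q ^ 2) + E := by
  have ht : t ^ 2 ≤ t := by nlinarith
  have hq := sq_nonneg q
  have hamgm : K * (t * (p * q)) ≤ c / 4 * p ^ 2 + K ^ 2 / c * (t * q ^ 2) := by
    have e1 : K ^ 2 / c * (t ^ 2 * q ^ 2) ≤ K ^ 2 / c * (t * q ^ 2) := by gcongr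
    have e2 : c / 4 * p ^ 2 + K ^ 2 / c * (t ^ 2 * q ^ 2) - K * (t * (p * q))
        = (c / 2 * p - K * t * q) ^ 2 / c := by
      field_simp
      ring
    have e3 : 0 ≤ (c / 2 * p - K * t * q) ^ 2 / c := by positivity
    linarith
  rcases le_or_gt (t ^ 2) (c / 2) with hcase | hcase
  · have e1 : 1 / 2 * t ^ 2 * p ^ 2 ≤ c / 4 * p ^ 2 :=
      mul_le_mul_of_nonneg_right (by linarith) (sq_nonneg p)
    have e2 : 0 ≤ 2 * (K + c) / c * (t * q ^ 2) := by positivity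
    linarith
  · have e1 : 1 ≤ 2 / c * t := by
      rw [div_mul_eq_mul_div, le_div_iff₀ hc]
      linarith
    have e2 : (K + c) * q ^ 2 ≤ 2 * (K + c) / c * (t * q ^ 2) := by
      calc (K + c) * q ^ 2 = 1 * ((K + c) * q ^ 2) := (one_mul _).symm
        _ ≤ (2 / c * t) * ((K + c) * q ^ 2) := mul_le_mul_of_nonneg_right e1 (by positivity)
        _ = 2 * (K + c) / c * (t * q ^ 2) := by ring
    have e3 : 0 ≤ c / 4 * p ^ 2 := by positivity
    linarith

/-- With `L` half the relaxation parameter, multiplying by `t + δ * L` turns the claim into a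
perfect square; the hypothesis on `A` is the worst case `t = a`. -/
lemma relaxation_quadratic_bound {p q t a δ A L : ℝ} (hL : 0 < L) (hL1 : L ≤ 1) (ht0 : 0 ≤ t)
    (hta : t ≤ a) (hδ : 0 < δ) (hA : 0 ≤ A) (h : (a + δ * L) * A ≤ (1 - L) * δ) :
    A * q ^ 2 ≤ (1 - L) / L * (t ^ 2 * p ^ 2 - 2 * (t * (p * q)) + q ^ 2)
      + t * δ * (1 - L) * p ^ 2 := by
  have hN : 0 < t + δ * L := by positivity
  have hNA : (t + δ * L) * A ≤ (1 - L) * δ :=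
    (mul_le_mul_of_nonneg_right (by linarith) hA).trans h
  have h1 := mul_le_mul_of_nonneg_right hNA (sq_nonneg q)
  have h2 : (t + δ * L) * ((1 - L) / L * (t ^ 2 * p ^ 2 - 2 * (t * (p * q)) + q ^ 2)
      + t * δ * (1 - L) * p ^ 2) - (1 - L) * δ * q ^ 2
      = (1 - L) * (t / L) * ((q - t * p) - δ * L * p) ^ 2 := by
    field_simp
    ring
  have h3 : 0 ≤ (1 - L) * (t / L) * ((q - t * p) - δ * L * p) ^ 2 :=
    mul_nonneg (mul_nonneg (by linarith) (by positivity)) (sq_nonneg _)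
  refine le_of_mul_le_mul_left ?_ hN
  linarith

variable {H : Type*} [NormedAddCommGroup H] [InnerProductSpace ℝ H]
variable {P : H → H} {φ : H → ℝ}

lemma residual_eq {x₀ x₁ x₂ m e : H} {t lam : ℝ} (hlam : 0 < lam)
    (hm : m = x₁ + t • (x₁ - x₀)) (hx₂ : x₂ = m + lam • (P m + e - m)) :
    m - P m = lam⁻¹ • (t • (x₁ - x₀) - (x₂ - x₁)) + e := by
  have h : t • (x₁ - x₀) - (x₂ - x₁) = lam • (m - P m - e) := by
    have : t • (x₁ - x₀) = m - x₁ := by rw [hm]; abel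
    rw [this, hx₂]
    module
  rw [h, smul_smul, inv_mul_cancel₀ hlam.ne', one_smul]
  abel

lemma IsProxLike.envelope_inertial_step_le (hP : IsProxLike P φ) {x₀ x₁ x₂ m e : H}
    {t lam l l' B : ℝ} (ht0 : 0 ≤ t) (ht1 : t ≤ 1) (hl : 0 < l) (hllam : l ≤ lam)
    (hlaml : lam ≤ l') (hl' : l' < 2) (hm : m = x₁ + t • (x₁ - x₀))
    (hx₂ : x₂ = m + lam • (P m + e - m)) (hB : ‖x₂ - x₁‖ ≤ B) :
    envelope P φ x₂ - envelope P φ x₁ ≤ -(1 / l' - 1 / 2) * ‖x₂ - x₁‖ ^ 2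
      + (1 / l' - 1 / 2) / 2 * ‖x₁ - x₀‖ ^ 2
      + ((1 / l + 1) ^ 2 / (1 / l' - 1 / 2) + 2 * ((1 / l + 1) + (1 / l' - 1 / 2))
        / (1 / l' - 1 / 2)) * (t * ‖x₂ - x₁‖ ^ 2) + ‖e‖ * B := by
  have hlam : 0 < lam := hl.trans_le hllam
  have hl'0 : 0 < l' := hlam.trans_le hlaml
  have hc : 0 < 1 / l' - 1 / 2 := sub_pos.mpr (one_div_lt_one_div_of_lt hl'0 hl')
  have hres := residual_eq hlam hm hx₂
  have hr0 : 0 < lam⁻¹ := inv_pos.mpr hlam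
  have hr1 : lam⁻¹ ≤ 1 / l := by
    rw [← one_div]; exact one_div_le_one_div_of_le hl hllam
  have hr2 : 1 / l' ≤ lam⁻¹ := by
    rw [← one_div]; exact one_div_le_one_div_of_le hlam hlaml
  have hx₁m : x₁ - m = -(t • (x₁ - x₀)) := by rw [hm]; abel
  have hx₂m : x₂ - m = (x₂ - x₁) - t • (x₁ - x₀) := by rw [hm]; abel
  have heB : ‖e‖ * ‖x₂ - x₁‖ ≤ ‖e‖ * B := mul_le_mul_of_nonneg_left hB (norm_nonneg _)
  have hu := hP.envelope_le x₂ m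
  have hlo := hP.le_envelope x₁ m
  have hu' := hP.envelope_le x₂ x₁
  have hlip := hP.norm_residual_sub_le x₁ m
  have hGx : ‖x₁ - P x₁‖ ≤ lam⁻¹ * (t * ‖x₁ - x₀‖ + ‖x₂ - x₁‖) + ‖e‖ + t * ‖x₁ - x₀‖ := by
    have e1 : ‖x₁ - P x₁‖ ≤ ‖(x₁ - P x₁) - (m - P m)‖ + ‖m - P m‖ := by
      simpa using norm_add_le ((x₁ - P x₁) - (m - P m)) (m - P m)
    have e2 : ‖x₁ - m‖ = t * ‖x₁ - x₀‖ := by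
      rw [hx₁m, norm_neg, norm_smul, Real.norm_eq_abs, abs_of_nonneg ht0]
    have e3 : ‖m - P m‖ ≤ lam⁻¹ * (t * ‖x₁ - x₀‖ + ‖x₂ - x₁‖) + ‖e‖ := by
      rw [hres]
      refine (norm_add_le _ _).trans (add_le_add_left ?_ _)
      rw [norm_smul, Real.norm_eq_abs, abs_of_pos hr0]
      refine mul_le_mul_of_nonneg_left ((norm_sub_le _ _).trans ?_) hr0.le
      rw [norm_smul, Real.norm_eq_abs, abs_of_nonneg ht0]
    linarith
  have hGd := (real_inner_le_norm (x₁ - P x₁) (x₂ - x₁)).trans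
    (mul_le_mul_of_nonneg_right hGx (norm_nonneg _))
  rw [hres, hx₂m] at hu
  rw [hres, hx₁m] at hlo
  have hcs := abs_real_inner_le_norm (x₁ - x₀) (x₂ - x₁)
  have hed := real_inner_le_norm e (x₂ - x₁)
  have hp0 := norm_nonneg (x₁ - x₀)
  have hq0 := norm_nonneg (x₂ - x₁)
  -- The first bound expands the envelope at `m`, where the residual is known from the step; the
  -- second expands it at `x₁`, which avoids a `‖x₁ - x₀‖ ^ 2` term.
  refine descent_of_two_bounds hc (by positivity) ht0 ht1 ?_ ?_
  · have e1 : (lam⁻¹ - 1) * ⟪x₁ - x₀, x₂ - x₁⟫ ≤ (1 / l + 1) * (‖x₁ - x₀‖ * ‖x₂ - x₁‖) := by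
      refine (le_abs_self _).trans ?_
      rw [abs_mul]
      refine mul_le_mul ?_ hcs (abs_nonneg _) (by positivity)
      rw [abs_le]
      have : 0 < 1 / l := by positivity
      constructor <;> linarith
    have e2 := mul_le_mul_of_nonneg_left e1 ht0
    have e3 := mul_le_mul_of_nonneg_right hr2 (sq_nonneg ‖x₂ - x₁‖)
    rw [norm_sub_sq_real (x₂ - x₁)] at hu
    generalize x₁ - x₀ = d at *
    generalize x₂ - x₁ = d' at *
    simp only [inner_add_left, inner_sub_left, inner_sub_right, inner_smul_left, inner_smul_right,
      inner_neg_right, norm_smul, conj_trivial, mul_pow, Real.norm_eq_abs, sq_abs,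
      real_inner_self_eq_norm_sq, real_inner_comm d d'] at hu hlo
    linarith
  · have e1 := mul_le_mul_of_nonneg_right hr1
      (by positivity : 0 ≤ t * (‖x₁ - x₀‖ * ‖x₂ - x₁‖) + ‖x₂ - x₁‖ ^ 2)
    have e2 := sq_nonneg ‖x₂ - x₁‖
    linarith

lemma IsProxLike.inertial_step_le_sub (hP : IsProxLike P φ) {s x₀ x₁ x₂ m e : H}
    {t lam a σ δ B : ℝ} (hs : P s = s) (ht0 : 0 ≤ t) (hta : t ≤ a) (hlam : 0 < lam)
    (hlam2 : lam ≤ 2) (hσ : 0 < σ) (hδ : 0 < δ)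
    (h : (a + δ * (lam / 2)) * (a * (1 + a) + a * δ + σ) ≤ (1 - lam / 2) * δ)
    (hm : m = x₁ + t • (x₁ - x₀)) (hx₂ : x₂ = m + lam • (P m + e - m))
    (hB : ‖t • (x₁ - x₀) - (x₂ - x₁)‖ ≤ B) (hBs : ‖x₂ - s‖ ≤ B) :
    ‖x₂ - s‖ ^ 2 - t * ‖x₁ - s‖ ^ 2 + (a * (1 + a) + a * δ) * ‖x₂ - x₁‖ ^ 2 ≤
      ‖x₁ - s‖ ^ 2 - t * ‖x₀ - s‖ ^ 2 + (a * (1 + a) + a * δ) * ‖x₁ - x₀‖ ^ 2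
        - σ * ‖x₂ - x₁‖ ^ 2 + 8 * B * ‖e‖ := by
  have ha : 0 ≤ a := ht0.trans hta
  have hstep := hP.inertial_step_le hs hlam.le hm hx₂
  have hres := residual_eq hlam hm hx₂
  set w := t • (x₁ - x₀) - (x₂ - x₁) with hw
  have hp0 := norm_nonneg (x₁ - x₀)
  have hq0 := norm_nonneg (x₂ - x₁)
  have hquad := relaxation_quadratic_bound (p := ‖x₁ - x₀‖) (q := ‖x₂ - x₁‖) (half_pos hlam)
    (by linarith) ht0 hta hδ (by positivity) h
  have hwsq : t ^ 2 * ‖x₁ - x₀‖ ^ 2 - 2 * (t * (‖x₁ - x₀‖ * ‖x₂ - x₁‖)) + ‖x₂ - x₁‖ ^ 2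
      ≤ ‖w‖ ^ 2 := by
    have hcs := mul_le_mul_of_nonneg_left (real_inner_le_norm (x₁ - x₀) (x₂ - x₁)) ht0
    rw [hw, norm_sub_sq_real (t • (x₁ - x₀)), norm_smul, inner_smul_left, mul_pow,
      Real.norm_eq_abs, sq_abs]
    simp only [conj_trivial]
    linarith
  -- The residual is `lam⁻¹ • w + e`. Its cross term costs `4 * B * ‖e‖`, and `herr` below costs as
  -- much, whence the factor 8.
  have hG : lam * (2 - lam) * ‖P m - m‖ ^ 2
      ≥ (1 - lam / 2) / (lam / 2) * ‖w‖ ^ 2 - 4 * B * ‖e‖ := by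
    have hin : -(B * ‖e‖) ≤ ⟪w, e⟫ :=
      (neg_le_neg (mul_le_mul_of_nonneg_right hB (norm_nonneg e))).trans
        (neg_le_of_abs_le (abs_real_inner_le_norm w e))
    have e1 : lam * (2 - lam) * ‖P m - m‖ ^ 2 = (1 - lam / 2) / (lam / 2) * ‖w‖ ^ 2
        + 2 * (2 - lam) * ⟪w, e⟫ + lam * (2 - lam) * ‖e‖ ^ 2 := by
      rw [norm_sub_rev, hres, norm_add_sq_real, norm_smul, inner_smul_left, mul_pow,
        Real.norm_eq_abs, sq_abs]
      simp only [conj_trivial]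
      field_simp
    have e2 : 0 ≤ lam * (2 - lam) * ‖e‖ ^ 2 :=
      mul_nonneg (mul_nonneg hlam.le (by linarith)) (sq_nonneg _)
    have e3 := mul_le_mul_of_nonneg_left hin (by linarith : 0 ≤ 2 * (2 - lam))
    have e4 : 0 ≤ lam * (B * ‖e‖) :=
      mul_nonneg hlam.le (mul_nonneg ((norm_nonneg _).trans hB) (norm_nonneg e))
    linarith
  have hw2 := mul_le_mul_of_nonneg_left hwsq
    (div_nonneg (by linarith) (by linarith) : 0 ≤ (1 - lam / 2) / (lam / 2))
  have herr : 2 * ‖x₂ - s‖ * lam * ‖e‖ ≤ 4 * B * ‖e‖ := by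
    refine mul_le_mul_of_nonneg_right ?_ (norm_nonneg e)
    have := mul_le_mul hBs hlam2 hlam.le ((norm_nonneg _).trans hBs)
    linarith
  have hcoef : t * (1 + t) + t * δ * (1 - lam / 2) ≤ a * (1 + a) + a * δ := by
    have e1 : t * (1 + t) ≤ a * (1 + a) := by gcongr
    have e2 : t * δ ≤ a * δ := by gcongr
    have e3 : 0 ≤ t * δ * (lam / 2) := by positivity
    linarith
  have hcoef2 := mul_le_mul_of_nonneg_right hcoef (sq_nonneg ‖x₁ - x₀‖)
  linarith

end Steps

/-! ### The three series of `Delta` and the best-iterate bound. -/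

section Terms

variable {H : Type*} [NormedAddCommGroup H] {α lam : ℕ → ℝ} {e z : ℕ → H} {a θ C : ℝ}

lemma norm_sub_le_of_bounded (hC : ∀ k, ‖z k‖ ≤ C) (i j : ℕ) : ‖z i - z j‖ ≤ 2 * C :=
  (norm_sub_le _ _).trans (by linarith [hC i, hC j])

lemma incTerm_nonneg (z : ℕ → H) (s : H) (j : ℕ) : 0 ≤ incTerm z s j :=
  le_max_right _ _

lemma inertiaTerm_nonneg (hα : ∀ k, 0 ≤ α k) (j : ℕ) : 0 ≤ inertiaTerm α z j := by
  have := hα (j + 1)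
  unfold inertiaTerm
  positivity

lemma errTerm_nonneg (hlam : ∀ k, 0 ≤ lam k) (s : H) (j : ℕ) : 0 ≤ errTerm lam e z s j := by
  have := hlam (j + 1)
  unfold errTerm
  positivity

lemma summable_inertiaTerm (hα : ∀ k, 0 ≤ α k ∧ α k ≤ a) (ha : a < 1)
    (hd : Summable fun k => ‖z (k + 1) - z k‖ ^ 2) : Summable (inertiaTerm α z) := by
  refine Summable.of_nonneg_of_le (fun j => ?_) (fun j => ?_) (hd.mul_left 2)
  · have := (hα (j + 1)).1
    unfold inertiaTerm
    positivity
  · refine mul_le_mul_of_nonneg_right ?_ (sq_nonneg _)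
    nlinarith [hα (j + 1)]

lemma summable_errTerm (hlam0 : ∀ k, 0 ≤ lam k) (hlam : ∀ k, lam k ≤ θ) (hC : ∀ k, ‖z k‖ ≤ C)
    (he : Summable fun k => ‖e k‖) (s : H) : Summable (errTerm lam e z s) := by
  refine Summable.of_nonneg_of_le (errTerm_nonneg hlam0 s) (fun j => ?_)
    (((summable_nat_add_iff 1).mpr he).mul_left (2 * (C + ‖s‖) * θ))
  refine mul_le_mul_of_nonneg_right ?_ (norm_nonneg _)
  have h0 : 0 ≤ C := (norm_nonneg _).trans (hC 0)
  have h1 : ‖z (j + 2) - s‖ ≤ C + ‖s‖ := (norm_sub_le _ _).trans (by linarith [hC (j + 2)])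
  exact mul_le_mul (by linarith) (hlam _) (hlam0 _) (by positivity)

lemma exists_tendsto_norm_sub {s : H} (h : Summable (incTerm z s)) :
    ∃ d, Tendsto (fun k => ‖z k - s‖) atTop (𝓝 d) := by
  obtain ⟨d, hd⟩ := exists_tendsto_of_summable_posPart (u := fun k => ‖z k - s‖ ^ 2)
    (fun k => sq_nonneg _) h
  exact ⟨√d, hd.sqrt.congr fun k => Real.sqrt_sq (norm_nonneg _)⟩

lemma inf'_Icc_le_of_sum_le {g : ℕ → ℝ} {c M : ℝ} (hc : 0 < c) {k : ℕ} (hk : 1 ≤ k)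
    (h : ∑ i ∈ Finset.range k, c * g (i + 1) ≤ M) :
    (Finset.Icc 1 k).inf' (Finset.nonempty_Icc.mpr hk) g ≤ 1 / (k * c) * M := by
  set m := (Finset.Icc 1 k).inf' (Finset.nonempty_Icc.mpr hk) g with hm
  have hk0 : (0 : ℝ) < k := by exact_mod_cast hk
  have h1 : ∑ _i ∈ Finset.range k, c * m ≤ ∑ i ∈ Finset.range k, c * g (i + 1) := by
    refine Finset.sum_le_sum fun i hi => mul_le_mul_of_nonneg_left ?_ hc.le
    refine Finset.inf'_le _ (Finset.mem_Icc.mpr ?_)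
    have := Finset.mem_range.mp hi
    omega
  rw [Finset.sum_const, Finset.card_range, nsmul_eq_mul] at h1
  rw [one_div, inv_mul_eq_div, le_div_iff₀ (by positivity)]
  linarith

end Terms

/-! ### Summability along the iteration. -/

section Iteration

variable {H : Type*} [NormedAddCommGroup H] [InnerProductSpace ℝ H]

/-- The inexact relaxed inertial iteration of a map `P`, from the index `1` on. -/
structure IsInertialIteration (P : H → H) (α lam : ℕ → ℝ) (e z μ : ℕ → H) : Prop where
  mu_succ : ∀ k, μ (k + 1) = z (k + 1) + α (k + 1) • (z (k + 1) - z k)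
  z_succ : ∀ k, z (k + 1) = μ k + lam k • (P (μ k) + e k - μ k)

variable {P : H → H} {φ : H → ℝ} {α lam : ℕ → ℝ} {e z μ : ℕ → H} {a l θ C : ℝ}

lemma IsInertialIteration.summable_of_summable_inertia (hP : IsProxLike P φ)
    (hit : IsInertialIteration P α lam e z μ) {s : H} (hs : P s = s)
    (hα : ∀ k, 0 ≤ α k ∧ α k ≤ a) (ha : a < 1) (hl : 0 < l)
    (hlam : ∀ k, l ≤ lam k ∧ lam k ≤ θ) (hθ : θ < 2) (hC : ∀ k, ‖z k‖ ≤ C)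
    (he : Summable fun k => ‖e k‖) (hin : Summable fun k => α k * ‖z (k + 1) - z k‖ ^ 2) :
    Summable fun k => ‖z (k + 1) - z k‖ ^ 2 := by
  have hθ0 : 0 < θ := hl.trans_le ((hlam 0).1.trans (hlam 0).2)
  have hc : 0 < 1 / θ - 1 / 2 := sub_pos.mpr (one_div_lt_one_div_of_lt hθ0 hθ)
  have hC0 : 0 ≤ C := (norm_nonneg _).trans (hC 0)
  set c := 1 / θ - 1 / 2 with hcdef
  set K := (1 / l + 1) ^ 2 / c + 2 * ((1 / l + 1) + c) / c with hK
  have hK0 : 0 ≤ K := by positivity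
  have hsum : Summable fun k => c / 2 * ‖z (k + 1 + 1) - z (k + 1)‖ ^ 2 := by
    refine summable_of_le_sub_add
      (u := fun k => envelope P φ (z (k + 1)) + c / 2 * ‖z (k + 1) - z k‖ ^ 2)
      (s := fun k => K * (α (k + 1) * ‖z (k + 1 + 1) - z (k + 1)‖ ^ 2)
        + ‖e (k + 1)‖ * (2 * C)) (c := envelope P φ s) ?_ ?_ ?_ ?_ ?_
    · intro k
      have h1 := hP.envelope_le_of_fixed hs (z (k + 1))
      have h2 : 0 ≤ c / 2 * ‖z (k + 1) - z k‖ ^ 2 := by positivity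
      linarith
    · intro k
      positivity
    · intro k
      have := (hα (k + 1)).1
      positivity
    · exact (((summable_nat_add_iff 1).mpr hin).mul_left K).add
        (((summable_nat_add_iff 1).mpr he).mul_right _)
    · intro k
      have h := hP.envelope_inertial_step_le (hα (k + 1)).1 ((hα (k + 1)).2.trans ha.le) hl
        (hlam (k + 1)).1 (hlam (k + 1)).2 hθ (hit.mu_succ k) (hit.z_succ (k + 1))
        (norm_sub_le_of_bounded hC _ _)
      rw [← hcdef, ← hK] at h
      show _ ≤ _
      linarith
  exact (summable_nat_add_iff 1).mp ((summable_mul_left_iff (half_pos hc).ne').mp hsum)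

lemma IsInertialIteration.summable_of_monotone (hP : IsProxLike P φ)
    (hit : IsInertialIteration P α lam e z μ) {s : H} (hs : P s = s)
    (hα : ∀ k, 0 ≤ α k ∧ α k ≤ a) (ha : a < 1) (hmono : Monotone α) {σ δ : ℝ} (hσ : 0 < σ)
    (hδ : 0 < δ) (hlam0 : ∀ k, 0 < lam k) (hlam2 : ∀ k, lam k ≤ 2)
    (h : ∀ k, (a + δ * (lam k / 2)) * (a * (1 + a) + a * δ + σ) ≤ (1 - lam k / 2) * δ)
    (hC : ∀ k, ‖z k‖ ≤ C) (he : Summable fun k => ‖e k‖) :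
    Summable fun k => ‖z (k + 1) - z k‖ ^ 2 := by
  have ha0 : 0 ≤ a := (hα 0).1.trans (hα 0).2
  have hC0 : 0 ≤ C := (norm_nonneg _).trans (hC 0)
  -- Large enough for both `‖z k - s‖` and the vector `w` of the one-step estimate, a sum of two
  -- differences of norm at most `2 * C`.
  set B := 4 * C + ‖s‖ with hB
  have hB0 : 0 ≤ B := by positivity
  have hzs : ∀ k, ‖z k - s‖ ≤ B := fun k => (norm_sub_le _ _).trans (by linarith [hC k])
  set Γ := a * (1 + a) + a * δ with hΓ
  have hΓ0 : 0 ≤ Γ := by positivity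
  have hsum : Summable fun k => σ * ‖z (k + 1 + 1) - z (k + 1)‖ ^ 2 := by
    refine summable_of_le_sub_add
      (u := fun k => ‖z (k + 1) - s‖ ^ 2 - α (k + 1) * ‖z k - s‖ ^ 2 + Γ * ‖z (k + 1) - z k‖ ^ 2)
      (s := fun k => 8 * B * ‖e (k + 1)‖) (c := -B ^ 2) ?_ ?_ ?_ ?_ ?_
    · intro k
      have h1 : α (k + 1) * ‖z k - s‖ ^ 2 ≤ 1 * B ^ 2 :=
        mul_le_mul ((hα _).2.trans ha.le) (pow_le_pow_left₀ (norm_nonneg _) (hzs k) 2)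
          (sq_nonneg _) zero_le_one
      have h2 : 0 ≤ Γ * ‖z (k + 1) - z k‖ ^ 2 := by positivity
      have h3 := sq_nonneg ‖z (k + 1) - s‖
      linarith
    · intro k
      positivity
    · intro k
      positivity
    · exact ((summable_nat_add_iff 1).mpr he).mul_left _
    · intro k
      have hw : ‖α (k + 1) • (z (k + 1) - z k) - (z (k + 1 + 1) - z (k + 1))‖ ≤ B := by
        refine (norm_sub_le _ _).trans ?_
        rw [norm_smul, Real.norm_eq_abs, abs_of_nonneg (hα _).1]
        have h1 := mul_le_mul ((hα (k + 1)).2.trans ha.le) (norm_sub_le_of_bounded hC (k + 1) k)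
          (norm_nonneg _) zero_le_one
        have h2 := norm_sub_le_of_bounded hC (k + 1 + 1) (k + 1)
        linarith [norm_nonneg s]
      have h1 := hP.inertial_step_le_sub hs (hα (k + 1)).1 (hα (k + 1)).2 (hlam0 (k + 1))
        (hlam2 (k + 1)) hσ hδ (h (k + 1)) (hit.mu_succ k) (hit.z_succ (k + 1)) hw (hzs (k + 1 + 1))
      -- Monotonicity replaces the weight `α (k + 1)` by `α (k + 2)`, so that the Lyapunov values
      -- telescope.
      have h2 := mul_le_mul_of_nonneg_right (hmono (Nat.le_succ (k + 1)))
        (sq_nonneg ‖z (k + 1) - s‖)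
      rw [← hΓ] at h1
      show _ ≤ _
      simp only [Nat.succ_eq_add_one] at h2
      linarith
  exact (summable_nat_add_iff 1).mp ((summable_mul_left_iff hσ.ne').mp hsum)

lemma IsInertialIteration.sub_le (hP : IsProxLike P φ) (hit : IsInertialIteration P α lam e z μ)
    {s : H} (hs : P s = s) (hα : ∀ k, 0 ≤ α k ∧ α k ≤ a) (hl : 0 < l)
    (hlam : ∀ k, l ≤ lam k ∧ lam k ≤ θ) (hθ : θ < 2) (k : ℕ) :
    ‖z (k + 2) - s‖ ^ 2 - ‖z (k + 1) - s‖ ^ 2 + l * (2 - θ) * ‖P (μ (k + 1)) - μ (k + 1)‖ ^ 2 ≤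
      a * incTerm z s k + errTerm lam e z s k + inertiaTerm α z k := by
  have h := hP.inertial_step_le hs (hl.le.trans (hlam (k + 1)).1) (hit.mu_succ k)
    (hit.z_succ (k + 1))
  have h1 : l * (2 - θ) ≤ lam (k + 1) * (2 - lam (k + 1)) :=
    mul_le_mul (hlam _).1 (by linarith [(hlam (k + 1)).2]) (by linarith)
      (hl.le.trans (hlam (k + 1)).1)
  have h2 := mul_le_mul_of_nonneg_right h1 (sq_nonneg ‖P (μ (k + 1)) - μ (k + 1)‖)
  have h3 : α (k + 1) * (‖z (k + 1) - s‖ ^ 2 - ‖z k - s‖ ^ 2) ≤ a * incTerm z s k :=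
    (mul_le_mul_of_nonneg_left (le_max_left _ _) (hα _).1).trans
      (mul_le_mul_of_nonneg_right (hα _).2 (le_max_right _ _))
  unfold errTerm inertiaTerm
  linarith

/-- Dropping the residual in `sub_le` and taking positive parts leaves a contraction of ratio `a`
with summable perturbation. -/
lemma IsInertialIteration.summable_incTerm (hP : IsProxLike P φ)
    (hit : IsInertialIteration P α lam e z μ) {s : H} (hs : P s = s)
    (hα : ∀ k, 0 ≤ α k ∧ α k ≤ a) (ha : a < 1) (hl : 0 < l)
    (hlam : ∀ k, l ≤ lam k ∧ lam k ≤ θ) (hθ : θ < 2)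
    (herr : Summable (errTerm lam e z s)) (hin : Summable (inertiaTerm α z)) :
    Summable (incTerm z s) := by
  have ha0 : 0 ≤ a := (hα 0).1.trans (hα 0).2
  have h0 : ∀ k, 0 ≤ errTerm lam e z s k + inertiaTerm α z k := fun k =>
    add_nonneg (errTerm_nonneg (fun k => hl.le.trans (hlam k).1) s k)
      (inertiaTerm_nonneg (fun k => (hα k).1) k)
  refine summable_of_le_mul_add ha (incTerm_nonneg z s) h0 (herr.add hin) fun k => ?_
  have h1 := hit.sub_le hP hs hα hl hlam hθ k
  have h2 : 0 ≤ l * (2 - θ) * ‖P (μ (k + 1)) - μ (k + 1)‖ ^ 2 :=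
    mul_nonneg (mul_nonneg hl.le (by linarith)) (sq_nonneg _)
  have h3 : 0 ≤ a * incTerm z s k := mul_nonneg ha0 (incTerm_nonneg z s k)
  refine max_le (by linarith) (by linarith [h0 k])

lemma IsInertialIteration.sum_residual_le (hP : IsProxLike P φ)
    (hit : IsInertialIteration P α lam e z μ) {s : H} (hs : P s = s)
    (hα : ∀ k, 0 ≤ α k ∧ α k ≤ a) (hl : 0 < l)
    (hlam : ∀ k, l ≤ lam k ∧ lam k ≤ θ) (hθ : θ < 2)
    (hinc : Summable (incTerm z s)) (herr : Summable (errTerm lam e z s))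
    (hin : Summable (inertiaTerm α z)) (n : ℕ) :
    ∑ k ∈ Finset.range n, l * (2 - θ) * ‖P (μ (k + 1)) - μ (k + 1)‖ ^ 2 ≤
      ‖z 1 - s‖ ^ 2 + Delta α lam e z a s := by
  have ha0 : 0 ≤ a := (hα 0).1.trans (hα 0).2
  have h1 : ∑ k ∈ Finset.range n, l * (2 - θ) * ‖P (μ (k + 1)) - μ (k + 1)‖ ^ 2 ≤
      ‖z 1 - s‖ ^ 2 - ‖z (n + 1) - s‖ ^ 2
        + ∑ k ∈ Finset.range n, (a * incTerm z s k + errTerm lam e z s k + inertiaTerm α z k) := by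
    induction n with
    | zero => simp
    | succ n ih =>
      rw [Finset.sum_range_succ, Finset.sum_range_succ]
      have := hit.sub_le hP hs hα hl hlam hθ n
      rw [show n + 1 + 1 = n + 2 from rfl]
      linarith
  have hsum := ((hinc.mul_left a).add herr).add hin
  have h2 := hsum.sum_le_tsum (Finset.range n) fun k _ =>
    add_nonneg (add_nonneg (mul_nonneg ha0 (incTerm_nonneg z s k))
      (errTerm_nonneg (fun k => hl.le.trans (hlam k).1) s k))
      (inertiaTerm_nonneg (fun k => (hα k).1) k)
  rw [((hinc.mul_left a).add herr).tsum_add hin, (hinc.mul_left a).tsum_add herr,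
    tsum_mul_left] at h2
  unfold Delta
  linarith [sq_nonneg ‖z (n + 1) - s‖]

/-- The residual map is 1-Lipschitz and `‖z (k + 1) - μ (k + 1)‖ ≤ ‖z (k + 1) - z k‖`, so smallness
transfers from `μ` to `z`. -/
lemma IsInertialIteration.tendsto_residual (hP : IsProxLike P φ)
    (hit : IsInertialIteration P α lam e z μ) (hα : ∀ k, 0 ≤ α k ∧ α k ≤ a) (ha : a < 1)
    (hd : Summable fun k => ‖z (k + 1) - z k‖ ^ 2)
    (hres : Summable fun k => ‖P (μ (k + 1)) - μ (k + 1)‖ ^ 2) :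
    Tendsto (fun k => z k - P (z k)) atTop (𝓝 0) := by
  have h1 : Tendsto (fun k => ‖P (μ (k + 1)) - μ (k + 1)‖) atTop (𝓝 0) := by
    simpa using hres.tendsto_atTop_zero.sqrt
  have h2 : Tendsto (fun k => ‖z (k + 1) - z k‖) atTop (𝓝 0) := by
    simpa using hd.tendsto_atTop_zero.sqrt
  refine (tendsto_add_atTop_iff_nat 1).mp (squeeze_zero_norm (fun k => ?_) (by
    simpa using h2.add h1))
  have h3 := hP.norm_residual_sub_le (z (k + 1)) (μ (k + 1))
  have h4 : ‖z (k + 1) - μ (k + 1)‖ ≤ 1 * ‖z (k + 1) - z k‖ := by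
    rw [hit.mu_succ k, sub_add_cancel_left, norm_neg, norm_smul, Real.norm_eq_abs,
      abs_of_nonneg (hα _).1]
    exact mul_le_mul_of_nonneg_right ((hα _).2.trans ha.le) (norm_nonneg _)
  have h5 : ‖z (k + 1) - P (z (k + 1))‖ ≤
      ‖(z (k + 1) - P (z (k + 1))) - (μ (k + 1) - P (μ (k + 1)))‖
        + ‖μ (k + 1) - P (μ (k + 1))‖ := by
    simpa using norm_add_le ((z (k + 1) - P (z (k + 1))) - (μ (k + 1) - P (μ (k + 1))))
      (μ (k + 1) - P (μ (k + 1)))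
  rw [norm_sub_rev (μ (k + 1))] at h5
  linarith

end Iteration

/-! ### Consequences of the bound `lamBar`, and the main theorem. -/

lemma lamBar_condition {a σ δ x : ℝ} (ha : 0 ≤ a) (hσ : 0 < σ) (hδ : 0 < δ)
    (hx : x ≤ lamBar a σ δ) :
    (a + δ * (x / 2)) * (a * (1 + a) + a * δ + σ) ≤ (1 - x / 2) * δ := by
  have hpos : 0 < δ * (1 + a * (1 + a) + a * δ + σ) := by positivity
  have h : x / 2 ≤ (δ - a * (a * (1 + a) + a * δ + σ)) / (δ * (1 + a * (1 + a) + a * δ + σ)) := by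
    unfold lamBar at hx
    linarith
  rw [le_div_iff₀ hpos] at h
  linarith

lemma lamBar_lt_two {a σ δ : ℝ} (ha : 0 ≤ a) (hσ : 0 < σ) (hδ : 0 < δ) : lamBar a σ δ < 2 := by
  have hpos : 0 < δ * (1 + a * (1 + a) + a * δ + σ) := by positivity
  have h : (δ - a * (a * (1 + a) + a * δ + σ)) / (δ * (1 + a * (1 + a) + a * δ + σ)) < 1 := by
    rw [div_lt_one hpos]
    have h1 : 0 ≤ a * (a * (1 + a) + a * δ + σ) := by positivity
    have h2 : 0 < δ * (a * (1 + a) + a * δ + σ) := by positivity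
    linarith
  unfold lamBar
  linarith

lemma IsProperConvexLsc.isProxLike {H : Type*} [NormedAddCommGroup H] [InnerProductSpace ℝ H]
    [CompleteSpace H] {f : H → EReal} (hf : IsProperConvexLsc f) (hΩ : (Argmin f).Nonempty)
    {ρ : ℝ} (hρ : 0 < ρ) :
    IsProxLike (prox f ρ) fun x => ρ * (f (prox f ρ x)).toReal := fun x m =>
  hf.prox_inner_le hΩ hρ m (EReal.le_coe_toReal (hf.prox_ne_top hΩ hρ x))

end InertialProx

open InertialProx

theorem corollary4p1 {H : Type*} [NormedAddCommGroup H] [InnerProductSpace ℝ H] [CompleteSpace H]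
    (f : H → EReal) (hf : InertialProx.IsProperConvexLsc f)
    (hΩ : (InertialProx.Argmin f).Nonempty)
    (ρ : ℝ) (hρ : 0 < ρ) (α lam : ℕ → ℝ) (e : ℕ → H) (zInit : H) (z μ : ℕ → H)
    (hgen : InertialProx.IsGenerated f ρ α lam e zInit z μ)
    (a l θ : ℝ)
    (hcond : (∃ l' : ℝ, InertialProx.ConditionsI α lam e z a l l' ∧ θ = l') ∨
      (∃ σ δ : ℝ, InertialProx.ConditionsII α lam e z a l σ δ ∧
        θ = InertialProx.lamBar a σ δ)) :
    (∀ zs ∈ InertialProx.Argmin f,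
      ∃ d : ℝ, Filter.Tendsto (fun k => ‖z k - zs‖) Filter.atTop (nhds d)) ∧
    (∃ zs ∈ InertialProx.Argmin f,
      Filter.Tendsto (fun k => toWeakSpace ℝ H (z k)) Filter.atTop
        (nhds (toWeakSpace ℝ H zs))) ∧
    (∀ zs ∈ InertialProx.Argmin f,
      Summable (InertialProx.incTerm z zs) ∧
      Summable (InertialProx.errTerm lam e z zs) ∧
      Summable (InertialProx.inertiaTerm α z) ∧
      ∀ (k : ℕ) (hk : 1 ≤ k),
        (Finset.Icc 1 k).inf' (Finset.nonempty_Icc.mpr hk)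
            (fun i => ‖InertialProx.prox f ρ (μ i) - μ i‖ ^ 2) ≤
          1 / (k * l * (2 - θ)) *
            (‖z 1 - zs‖ ^ 2 + InertialProx.Delta α lam e z a zs)) := by
  have hP := hf.isProxLike hΩ hρ
  have hfix := hf.mem_Argmin_iff_prox_eq hΩ hρ
  have hit : IsInertialIteration (prox f ρ) α lam e z μ := ⟨hgen.mu_succ, hgen.z_succ⟩
  obtain ⟨s₀, hs₀⟩ := hΩ
  -- All that the conclusion needs from either set of conditions; the rest of the argument is common
  -- to both.
  have hdata : ((∀ k, 0 ≤ α k ∧ α k ≤ a) ∧ a < 1 ∧ 0 < l ∧ (∀ k, l ≤ lam k ∧ lam k ≤ θ) ∧ θ < 2) ∧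
      Bornology.IsBounded (Set.range z) ∧ (Summable fun k => ‖e k‖) ∧
      Summable fun k => ‖z (k + 1) - z k‖ ^ 2 := by
    rcases hcond with ⟨l', h, rfl⟩ | ⟨σ, δ, h, rfl⟩
    · obtain ⟨C, hC⟩ := h.bounded.exists_norm_le
      have hC' : ∀ k, ‖z k‖ ≤ C := fun k => hC _ ⟨k, rfl⟩
      have he : Summable fun k => ‖e k‖ :=
        (summable_mul_left_iff h.l_pos.ne').mp (Summable.of_nonneg_of_le
          (fun k => mul_nonneg h.l_pos.le (norm_nonneg _))
          (fun k => mul_le_mul_of_nonneg_right (h.lam_mem k).1 (norm_nonneg _)) h.summable_error)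
      exact ⟨⟨h.alpha_mem, h.a_lt_one, h.l_pos, h.lam_mem, h.l'_lt_two⟩, h.bounded, he,
        hit.summable_of_summable_inertia hP ((hfix s₀).mp hs₀) h.alpha_mem h.a_lt_one h.l_pos
          h.lam_mem h.l'_lt_two hC' he h.summable_inertia⟩
    · obtain ⟨C, hC⟩ := h.bounded.exists_norm_le
      have hC' : ∀ k, ‖z k‖ ≤ C := fun k => hC _ ⟨k, rfl⟩
      have ha0 : 0 ≤ a := (h.alpha_mem 0).1.trans (h.alpha_mem 0).2
      have h2 := lamBar_lt_two ha0 h.σ_pos h.δ_pos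
      exact ⟨⟨h.alpha_mem, h.a_lt_one, h.l_pos, h.lam_mem, h2⟩, h.bounded, h.summable_error,
        hit.summable_of_monotone hP ((hfix s₀).mp hs₀) h.alpha_mem h.a_lt_one h.alpha_mono
          h.σ_pos h.δ_pos (fun k => h.l_pos.trans_le (h.lam_mem k).1)
          (fun k => (h.lam_mem k).2.trans h2.le)
          (fun k => lamBar_condition ha0 h.σ_pos h.δ_pos (h.lam_mem k).2) hC' h.summable_error⟩
  obtain ⟨⟨hα, ha, hl, hlam, hθ⟩, hbdd, he, hd⟩ := hdata
  obtain ⟨C, hC⟩ := hbdd.exists_norm_le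
  replace hC : ∀ k, ‖z k‖ ≤ C := fun k => hC _ ⟨k, rfl⟩
  have hin := summable_inertiaTerm hα ha hd
  have herr := fun s => summable_errTerm (fun k => hl.le.trans (hlam k).1) (fun k => (hlam k).2)
    hC he s
  have hinc : ∀ s ∈ Argmin f, Summable (incTerm z s) := fun s hs =>
    hit.summable_incTerm hP ((hfix s).mp hs) hα ha hl hlam hθ (herr s) hin
  have hc : 0 < l * (2 - θ) := mul_pos hl (by linarith)
  have hsum := fun s (hs : s ∈ Argmin f) => hit.sum_residual_le hP ((hfix s).mp hs) hα hl hlam hθ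
    (hinc s hs) (herr s) hin
  have hlim : ∀ s ∈ Argmin f, ∃ d : ℝ, Filter.Tendsto (fun k => ‖z k - s‖) Filter.atTop (nhds d) :=
    fun s hs => exists_tendsto_norm_sub (hinc s hs)
  have hres := hit.tendsto_residual hP hα ha hd ((summable_mul_left_iff hc.ne').mp
    (summable_of_sum_range_le (fun k => mul_nonneg hc.le (sq_nonneg _)) (hsum s₀ hs₀)))
  refine ⟨hlim, exists_tendsto_weak_of_opial hC hlim fun U x hU hx => ?_, fun s hs => ?_⟩
  · exact (hfix x).mpr (hP.fixed_of_tendsto_inner hC hx (hres.mono_left hU))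
  · refine ⟨hinc s hs, herr s, hin, fun k hk => ?_⟩
    rw [mul_assoc]
    exact inf'_Icc_le_of_sum_le hc hk (hsum s hs k)
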